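/- Let $n \ge 1$ and let $B_n$ be Artin's braid group, with generators $\sigma_1,\dots,\sigma_{n-1}$ and relations $\sigma_i\sigma_{i+1}\sigma_i=\sigma_{i+1}\sigma_i\sigma_{i+1}$ and $\sigma_i\sigma_j=\sigma_j\sigma_i$ for $|i-j|>1$. Let $q_1,q_2\in\mathbb{C}$ with $q_1q_2\neq 0$, and put $q=-q_2/q_1$. The generalized Burau representation is the representation of $B_n$ on $E=\mathbb{C}^n$, with standard basis $e_1,\dots,e_n$, given by $$\sigma_i\cdot e_i=(q_1+q_2)e_i+q_1e_{i+1},\qquad \sigma_i\cdot e_{i+1}=-q_2e_i,\qquad \sigma_i\cdot e_j=q_1e_j\quad (j\neq i,i+1).$$ The subspace $F\subseteq E$ spanned by the vectors $f_i=q_2e_i+q_1e_{i+1}$ $(1\le i\le n-1)$ is $B_n$-stable; the resulting homomorphism $\rho:B_n\to \mathrm{GL}(F)$ is the (generalized) reduced Burau representation. Assume that $q$ is not a root of unity, i.e. $q^m\ne 1$ for all integers $m\ge 1$. Then the Zariski closure of $\rho(B_n)$ in $\mathrm{GL}(F)$ contains $\mathrm{SL}(F)$. Moreover, for every integer $k\ge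 0$, $$\mathrm{End}_{B_n}(F^{\otimes k})=\mathrm{End}_{\mathrm{GL}(F)}(F^{\otimes k}),$$ where tensor powers are over $\mathbb{C}$ and $B_n$ (through $\rho$) and $\mathrm{GL}(F)$ act diagonally on $F^{\otimes k}$. -/

import Mathlib

open scoped TensorProduct

noncomputable section

/-! ### Artin's braid group -/

/-- The braid relations on the generators `σ_1, …, σ_{n-1}` (indexed from `0` by `Fin (n - 1)`).
The commutation relation is symmetric in `i, j`, so it is listed for `i + 1 < j` only. -/
def braidRels (n : ℕ) : Set (FreeGroup (Fin (n - 1))) :=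
  {r | ∃ i j : Fin (n - 1), (i : ℕ) + 1 = j ∧
      r = FreeGroup.of i * FreeGroup.of j * FreeGroup.of i *
        (FreeGroup.of j * FreeGroup.of i * FreeGroup.of j)⁻¹} ∪
  {r | ∃ i j : Fin (n - 1), (i : ℕ) + 1 < j ∧
      r = FreeGroup.of i * FreeGroup.of j * (FreeGroup.of j * FreeGroup.of i)⁻¹}

/-- Artin's braid group `B_n` on `n` strands. -/
abbrev BraidGroup (n : ℕ) : Type := PresentedGroup (braidRels n)

namespace Burau

variable {n : ℕ}

/-! ### The generalized Burau representation -/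

/-- The position `i` in `{1, …, n}` (indexed from `0`), for `i = 1, …, n - 1`. -/
def lo (i : Fin (n - 1)) : Fin n := ⟨i, by omega⟩

/-- The position `i + 1` in `{1, …, n}` (indexed from `0`), for `i = 1, …, n - 1`. -/
def hi (i : Fin (n - 1)) : Fin n := ⟨i + 1, by omega⟩

/-- The standard basis vector `e_j` of `E = ℂⁿ`. -/
def e (j : Fin n) : Fin n → ℂ := Pi.single j 1

/-- The operator by which `σ_i` acts on `E = ℂⁿ`:
`e_i ↦ (q₁ + q₂) e_i + q₁ e_{i+1}`, `e_{i+1} ↦ -q₂ e_i`, and `e_j ↦ q₁ e_j` for `j ≠ i, i + 1`. -/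
def op (q₁ q₂ : ℂ) (i : Fin (n - 1)) : Module.End ℂ (Fin n → ℂ) :=
  (Pi.basisFun ℂ (Fin n)).constr ℂ fun j =>
    if j = lo i then (q₁ + q₂) • e (lo i) + q₁ • e (hi i)
    else if j = hi i then (-q₂) • e (lo i)
    else q₁ • e j

theorem lo_ne_hi (i : Fin (n - 1)) : lo i ≠ hi i := by
  simp [lo, hi, Fin.ext_iff]

theorem op_apply (q₁ q₂ : ℂ) (i : Fin (n - 1)) (v : Fin n → ℂ) (j : Fin n) :
    op q₁ q₂ i v j =
      if j = lo i then (q₁ + q₂) * v (lo i) - q₂ * v (hi i)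
      else if j = hi i then q₁ * v (lo i)
      else q₁ * v j := by
  have key : op q₁ q₂ i =
      LinearMap.pi (fun j : Fin n =>
        if j = lo i then (q₁ + q₂) • LinearMap.proj (lo i) - q₂ • LinearMap.proj (hi i)
        else if j = hi i then q₁ • LinearMap.proj (lo i)
        else q₁ • LinearMap.proj (R := ℂ) (φ := fun _ : Fin n => ℂ) j) := by
    refine (Pi.basisFun ℂ (Fin n)).ext fun k => ?_
    rw [op, Module.Basis.constr_basis]
    have h := lo_ne_hi i
    ext j
    simp only [Pi.basisFun_apply, LinearMap.pi_apply, e]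
    by_cases h1 : k = lo i
    · subst h1
      by_cases h3 : j = lo i
      · subst h3; simp [h.symm]
      · by_cases h4 : j = hi i
        · subst h4; simp [h.symm]
        · simp [h3, h4]
    · by_cases h2 : k = hi i
      · subst h2
        by_cases h3 : j = lo i
        · subst h3; simp [h, h.symm]
        · by_cases h4 : j = hi i
          · subst h4; simp [h, h.symm]
          · simp [h3, h4, h.symm]
      · by_cases h3 : j = lo i
        · subst h3; simp [h1, h2, Ne.symm h1, Ne.symm h2]
        · by_cases h4 : j = hi i
          · subst h4; simp [h1, h2, h.symm, Ne.symm h1, Ne.symm h2]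
          · simp [h1, h2, h3, h4, Pi.single_apply]
  rw [key, LinearMap.pi_apply]
  split_ifs <;> simp

/-- The quadratic relation `(T - q₁)(T - q₂) = 0`. -/
theorem op_op (q₁ q₂ : ℂ) (i : Fin (n - 1)) (v : Fin n → ℂ) :
    op q₁ q₂ i (op q₁ q₂ i v) = (q₁ + q₂) • op q₁ q₂ i v - (q₁ * q₂) • v := by
  have h := lo_ne_hi i
  ext j
  by_cases h3 : j = lo i
  · subst h3; simp [op_apply, h.symm]; ring
  · by_cases h4 : j = hi i
    · subst h4; simp [op_apply, h.symm]; ring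
    · simp [op_apply, h3, h4]; ring

theorem op_braid (q₁ q₂ : ℂ) (i j : Fin (n - 1)) (hij : (i : ℕ) + 1 = j) :
    op q₁ q₂ i * op q₁ q₂ j * op q₁ q₂ i = op q₁ q₂ j * op q₁ q₂ i * op q₁ q₂ j := by
  have h1 : hi i = lo j := by simp [lo, hi, hij]
  have h2 : lo i ≠ lo j := by simp only [lo, ne_eq, Fin.ext_iff]; omega
  have h3 : lo i ≠ hi j := by simp only [lo, hi, ne_eq, Fin.ext_iff]; omega
  have h4 := lo_ne_hi j
  refine LinearMap.ext fun v => funext fun k => ?_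
  simp only [Module.End.mul_apply, op_apply, h1]
  simp only [h2, h3, h4, h2.symm, h3.symm, h4.symm, if_true, if_false]
  split_ifs <;> first | ring1 | (exfalso; simp_all)

theorem op_comm (q₁ q₂ : ℂ) (i j : Fin (n - 1)) (hij : (i : ℕ) + 1 < j) :
    op q₁ q₂ i * op q₁ q₂ j = op q₁ q₂ j * op q₁ q₂ i := by
  have h1 : lo i ≠ lo j := by simp only [lo, ne_eq, Fin.ext_iff]; omega
  have h2 : lo i ≠ hi j := by simp only [lo, hi, ne_eq, Fin.ext_iff]; omega
  have h3 : hi i ≠ lo j := by simp only [lo, hi, ne_eq, Fin.ext_iff]; omega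
  have h4 : hi i ≠ hi j := by simp only [hi, ne_eq, Fin.ext_iff]; omega
  refine LinearMap.ext fun v => funext fun k => ?_
  simp only [Module.End.mul_apply, op_apply]
  simp only [h1, h2, h3, h4, h1.symm, h2.symm, h3.symm, h4.symm, if_false]
  split_ifs <;> first | ring1 | (exfalso; simp_all)

/-- The invertible operator by which `σ_i` acts on `E`, when `q₁ q₂ ≠ 0`. -/
def unitOp (q₁ q₂ : ℂ) (hq : q₁ * q₂ ≠ 0) (i : Fin (n - 1)) :
    LinearMap.GeneralLinearGroup ℂ (Fin n → ℂ) where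
  val := op q₁ q₂ i
  inv := (q₁ * q₂)⁻¹ • ((q₁ + q₂) • 1 - op q₁ q₂ i)
  val_inv := by
    refine LinearMap.ext fun v => ?_
    have h : q₂⁻¹ * q₁⁻¹ * (q₁ * q₂) = 1 := by rw [← mul_inv_rev, inv_mul_cancel₀ hq]
    simp [op_op, smul_smul, h]
  inv_val := by
    refine LinearMap.ext fun v => ?_
    have h : q₂⁻¹ * q₁⁻¹ * (q₁ * q₂) = 1 := by rw [← mul_inv_rev, inv_mul_cancel₀ hq]
    simp [op_op, smul_smul, h]

/-- The generalized Burau representation `B_n → GL(E)`, `σ_i ↦ β_i`. -/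
def burau (n : ℕ) (q₁ q₂ : ℂ) (hq : q₁ * q₂ ≠ 0) :
    BraidGroup n →* LinearMap.GeneralLinearGroup ℂ (Fin n → ℂ) :=
  PresentedGroup.toGroup (f := unitOp q₁ q₂ hq) (by
    rintro r (⟨i, j, hij, rfl⟩ | ⟨i, j, hij, rfl⟩)
    · simp only [map_mul, map_inv, FreeGroup.lift_apply_of]
      exact mul_inv_eq_one.2 (Units.ext (op_braid q₁ q₂ i j hij))
    · simp only [map_mul, map_inv, FreeGroup.lift_apply_of]
      exact mul_inv_eq_one.2 (Units.ext (op_comm q₁ q₂ i j hij)))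

/-! ### The reduced Burau representation -/

/-- The vector `f_i = q₂ e_i + q₁ e_{i+1}`. -/
def f (q₁ q₂ : ℂ) (i : Fin (n - 1)) : Fin n → ℂ := q₂ • e (lo i) + q₁ • e (hi i)

/-- The subspace `F` of `E = ℂⁿ` spanned by `f_1, …, f_{n-1}`. -/
def F (n : ℕ) (q₁ q₂ : ℂ) : Submodule ℂ (Fin n → ℂ) :=
  Submodule.span ℂ (Set.range (f (n := n) q₁ q₂))

/-- `T_i - q₁` maps `E` into the line spanned by `f_i`. -/
theorem op_eq (q₁ q₂ : ℂ) (i : Fin (n - 1)) (v : Fin n → ℂ) :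
    op q₁ q₂ i v = q₁ • v + (v (lo i) - v (hi i)) • f q₁ q₂ i := by
  have h := lo_ne_hi i
  ext j
  by_cases h3 : j = lo i
  · subst h3; simp [op_apply, f, e, h]; ring
  · by_cases h4 : j = hi i
    · subst h4; simp [op_apply, f, e, h.symm]; ring
    · simp [op_apply, f, e, h3, h4]

theorem op_mem_F (q₁ q₂ : ℂ) (i : Fin (n - 1)) {v : Fin n → ℂ} (hv : v ∈ F n q₁ q₂) :
    op q₁ q₂ i v ∈ F n q₁ q₂ := by
  rw [op_eq]
  exact add_mem (Submodule.smul_mem _ _ hv)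
    (Submodule.smul_mem _ _ (Submodule.subset_span ⟨i, rfl⟩))

theorem burau_mem_F (q₁ q₂ : ℂ) (hq : q₁ * q₂ ≠ 0) (g : BraidGroup n) {v : Fin n → ℂ}
    (hv : v ∈ F n q₁ q₂) :
    (burau n q₁ q₂ hq g : Module.End ℂ (Fin n → ℂ)) v ∈ F n q₁ q₂ := by
  have hg : g ∈ Subgroup.closure (Set.range (PresentedGroup.of (rels := braidRels n))) := by
    rw [PresentedGroup.closure_range_of]; trivial
  induction hg using Subgroup.closure_induction'' generalizing v with
  | one => simpa using hv
  | mem x hx =>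
    obtain ⟨i, rfl⟩ := hx
    rw [burau, PresentedGroup.toGroup.of]
    exact op_mem_F q₁ q₂ i hv
  | inv_mem x hx =>
    obtain ⟨i, rfl⟩ := hx
    rw [map_inv, burau, PresentedGroup.toGroup.of]
    change ((q₁ * q₂)⁻¹ • ((q₁ + q₂) • (1 : Module.End ℂ (Fin n → ℂ)) - op q₁ q₂ i)) v ∈ _
    exact Submodule.smul_mem _ _ (sub_mem (Submodule.smul_mem _ _ hv) (op_mem_F q₁ q₂ i hv))
  | mul x y _ _ hx hy =>
    rw [map_mul, Units.val_mul, Module.End.mul_apply]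
    exact hx (hy hv)

/-- The (generalized) reduced Burau representation `ρ : B_n → GL(F)`: the restriction to the
invariant subspace `F` of the generalized Burau representation. -/
def reducedBurau (n : ℕ) (q₁ q₂ : ℂ) (hq : q₁ * q₂ ≠ 0) :
    BraidGroup n →* LinearMap.GeneralLinearGroup ℂ (F n q₁ q₂) :=
  MonoidHom.toHomUnits
    { toFun := fun g =>
        (burau n q₁ q₂ hq g : Module.End ℂ (Fin n → ℂ)).restrict
          fun _ hv => burau_mem_F q₁ q₂ hq g hv
      map_one' := by ext; simp
      map_mul' := fun x y => by ext; simp }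

end Burau

/-! ### The Zariski topology on `GL(V)` -/

section Zariski

variable (V : Type*) [AddCommGroup V] [Module ℂ V]

/-- The coordinate ring of the algebraic group `GL(V)`, for a finite-dimensional complex vector
space `V`: the functions on `GL(V)` that are polynomials in the matrix coefficients
`g ↦ φ (g v)` and in `g ↦ (det g)⁻¹`. -/
def regularFunctions : Subalgebra ℂ (LinearMap.GeneralLinearGroup ℂ V → ℂ) :=
  Algebra.adjoin ℂ
    ({c | ∃ (φ : Module.Dual ℂ V) (v : V),
        c = fun g : LinearMap.GeneralLinearGroup ℂ V => φ ((g : Module.End ℂ V) v)} ∪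
      {fun g : LinearMap.GeneralLinearGroup ℂ V => (LinearMap.det (g : Module.End ℂ V))⁻¹})

variable {V}

/-- A Zariski-closed subset of `GL(V)`: the common zero set of a set of regular functions. -/
def IsZariskiClosed (Z : Set (LinearMap.GeneralLinearGroup ℂ V)) : Prop :=
  ∃ I : Set (LinearMap.GeneralLinearGroup ℂ V → ℂ),
    I ⊆ regularFunctions V ∧ Z = {g | ∀ c ∈ I, c g = 0}

/-- The Zariski closure in `GL(V)`: the intersection of all Zariski-closed sets containing `S`. -/
def zariskiClosure (S : Set (LinearMap.GeneralLinearGroup ℂ V)) :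
    Set (LinearMap.GeneralLinearGroup ℂ V) :=
  ⋂₀ {Z | IsZariskiClosed Z ∧ S ⊆ Z}

end Zariski

/-! ### Endomorphisms of tensor powers -/

/-- For a group `G` acting linearly on `V` through `ρ : G → GL(V)`, the algebra
`End_G(V^{⊗k})` of all endomorphisms of `V^{⊗k}` that commute with the diagonal action
`g ↦ ρ(g) ⊗ ⋯ ⊗ ρ(g)` of `G`. -/
def tensorPowerEnd {G : Type*} [Group G] {V : Type*} [AddCommGroup V] [Module ℂ V]
    (ρ : G →* LinearMap.GeneralLinearGroup ℂ V) (k : ℕ) :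
    Subalgebra ℂ (Module.End ℂ (⨂[ℂ] _ : Fin k, V)) :=
  Subalgebra.centralizer ℂ
    (Set.range fun g : G => PiTensorProduct.map fun _ : Fin k => (ρ g : Module.End ℂ V))

end

open scoped TensorProduct

noncomputable section

/-! On `F` each generator acts as `q₁` times a dilation: it fixes the hyperplane `ker (coroot i)` up
to the factor `q₁` and scales `f_i` by the further factor `-q`. Since `q` is not a root of unity,
`-q` has infinite order, so its powers are Zariski dense in `ℂˣ`. The powers of a single generator
should therefore see the whole one-parameter group `d_i(t)` of dilations, were it not for the
central factors `q₁ ^ m`, which need not be controllable.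

Conjugation removes these factors. For `s` in the image `Γ` of the braid group, `d_i(t) s d_i(t)⁻¹`
lies in `Γ` at every `t = (-q)^m`. A regular function along this curve is a Laurent polynomial in
`t`, so one vanishing on `Γ` vanishes for all `t` (`dilation_conj_mem_zariskiClosure`). Hence all
`d_i(t)` normalize the closure of `Γ`, and the same argument places every commutator `⁅d_i(t),
d_j(u)⁆` in it. If `K` is the group generated by all `d_i(t)`, the closure thus contains `⁅K, K⁆`.

It remains to see that `K` is large: it contains every invertible `1 + c x ⊗ φ`. The pairs `(x, φ)`
for which this holds (`HasRoot`) are stable under conjugation by `K` and additive in each variable,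
so each `f_i ⊗ coroot j` can be reached along the chain of generators (`HasRoot.of_chain`). The
roots span `F` and the coroots span its dual, so all pairs follow. Special linear maps are products
of commutators of such elements (`mem_of_det_eq_one`), which gives the first claim.

For tensor powers, commuting with `g ⊗ ⋯ ⊗ g` is a Zariski-closed condition on `g`. It passes from
`Γ` to the special linear group, and then to the general linear group because scalars act on a
tensor power by scalars. -/

/-! ### Groups containing all maps `1 + c • x ⊗ φ` -/

section Roots

open LinearMap (transvection)
open Module (Dual)

variable {V : Type*} [AddCommGroup V] [Module ℂ V]

/-- The subgroup `K` contains every invertible map of the form `v ↦ v + c φ(v) x`. -/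
def HasRoot (K : Subgroup (LinearMap.GeneralLinearGroup ℂ V)) (x : V) (φ : Dual ℂ V) : Prop :=
  ∀ c : ℂ, 1 + c * φ x ≠ 0 → ∃ g ∈ K, (g : Module.End ℂ V) = transvection φ (c • x)

namespace HasRoot

variable {K : Subgroup (LinearMap.GeneralLinearGroup ℂ V)} {x y : V} {φ ψ : Dual ℂ V}

theorem conj (h : HasRoot K x φ) {k : LinearMap.GeneralLinearGroup ℂ V} (hk : k ∈ K)
    (hx : (k : Module.End ℂ V) y = x) (hφ : φ ∘ₗ (k : Module.End ℂ V) = ψ) : HasRoot K y ψ := by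
  intro c hc
  subst hx hφ
  obtain ⟨g, hg, hgc⟩ := h c hc
  refine ⟨k⁻¹ * g * k, K.mul_mem (K.mul_mem (K.inv_mem hk) hg) hk, ?_⟩
  have hk' : ∀ v, (↑k⁻¹ : Module.End ℂ V) ((k : Module.End ℂ V) v) = v := fun v => by
    rw [← Module.End.mul_apply, Units.inv_mul, Module.End.one_apply]
  ext v
  simp [hgc, LinearMap.transvection.apply, hk']

theorem smul_left (h : HasRoot K x φ) (a : ℂ) : HasRoot K (a • x) φ := by
  intro c hc
  simpa [smul_smul] using h (c * a) (by simpa [mul_assoc] using hc)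

theorem smul_right (h : HasRoot K x φ) (a : ℂ) : HasRoot K x (a • φ) := by
  intro c hc
  obtain ⟨g, hg, hgc⟩ := h (c * a) (by simpa [mul_assoc] using hc)
  refine ⟨g, hg, ?_⟩
  ext v
  simp only [hgc, LinearMap.transvection.apply, LinearMap.smul_apply, smul_eq_mul]
  module

theorem zero_left (K : Subgroup (LinearMap.GeneralLinearGroup ℂ V)) (φ : Dual ℂ V) :
    HasRoot K 0 φ := fun c _ => ⟨1, K.one_mem, by ext; simp⟩

theorem zero_right (K : Subgroup (LinearMap.GeneralLinearGroup ℂ V)) (x : V) :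
    HasRoot K x 0 := fun c _ => ⟨1, K.one_mem, by ext; simp⟩

/-- Rests on the factorization `1 + c (x + y) ⊗ φ = (1 + c' x ⊗ φ)(1 + c y ⊗ φ)` with `c' = c / (1 +
c φ(y))`, which needs the second factor to be invertible. -/
theorem exists_of_add_left (hx : HasRoot K x φ) (hy : HasRoot K y φ) {c : ℂ}
    (hc : 1 + c * φ (x + y) ≠ 0) (hcy : 1 + c * φ y ≠ 0) :
    ∃ g ∈ K, (g : Module.End ℂ V) = transvection φ (c • (x + y)) := by
  rw [map_add] at hc
  obtain ⟨g, hg, hgc⟩ := hx (c / (1 + c * φ y)) (by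
    intro h0
    apply hc
    field_simp at h0
    linear_combination h0)
  obtain ⟨g', hg', hgc'⟩ := hy c hcy
  refine ⟨g * g', K.mul_mem hg hg', ?_⟩
  ext v
  simp only [Units.val_mul, Module.End.mul_apply, hgc, hgc', LinearMap.transvection.apply, map_add,
    map_smul]
  match_scalars
  · ring
  · field_simp
  · ring

theorem exists_of_add_right (hx : HasRoot K x φ) (hy : HasRoot K x ψ) {c : ℂ}
    (hc : 1 + c * (φ + ψ) x ≠ 0) (hcy : 1 + c * ψ x ≠ 0) :
    ∃ g ∈ K, (g : Module.End ℂ V) = transvection (φ + ψ) (c • x) := by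
  rw [LinearMap.add_apply] at hc
  obtain ⟨g, hg, hgc⟩ := hx (c / (1 + c * ψ x)) (by
    intro h0
    apply hc
    field_simp at h0
    linear_combination h0)
  obtain ⟨g', hg', hgc'⟩ := hy c hcy
  refine ⟨g' * g, K.mul_mem hg' hg, ?_⟩
  ext v
  simp only [Units.val_mul, Module.End.mul_apply, hgc, hgc', LinearMap.transvection.apply, map_add,
    map_smul, LinearMap.add_apply]
  match_scalars
  · ring
  · field_simp
    ring

/-- If `1 + c (a + b) = -1` with `1 + c a = 1 + c b = 0`, then `v ↦ v + c φ(v) x` is a square of a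
map of the same form for which the two degeneracies disappear. -/
theorem exists_of_sq (hx : ∀ c : ℂ, 1 + c * φ x ≠ 0 → 2 + c * φ x ≠ 0 →
      ∃ g ∈ K, (g : Module.End ℂ V) = transvection φ (c • x)) : HasRoot K x φ := by
  intro c hc
  by_cases h2 : 2 + c * φ x = 0
  · have hI : (1 + Complex.I) ≠ 0 := fun h => by simpa using congrArg Complex.re h
    have hI' : Complex.I ≠ 0 := Complex.I_ne_zero
    have hII := Complex.I_mul_I
    -- Since `c φ(x) = -2`, the new coefficient gives the eigenvalue `I` on `x`, a square root of
    -- `-1`.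
    obtain ⟨g, hg, hgc⟩ := hx (c * ((1 - Complex.I) / 2))
      (by rw [show 1 + c * ((1 - Complex.I) / 2) * φ x = Complex.I by
            linear_combination (1 - Complex.I) / 2 * h2]
          exact hI')
      (by rw [show 2 + c * ((1 - Complex.I) / 2) * φ x = 1 + Complex.I by
            linear_combination (1 - Complex.I) / 2 * h2]
          exact hI)
    refine ⟨g * g, K.mul_mem hg hg, ?_⟩
    ext v
    simp only [Units.val_mul, Module.End.mul_apply, hgc, LinearMap.transvection.apply, map_add,
      map_smul]
    match_scalars
    · ring
    · linear_combination φ v * c * ((1 - Complex.I) / 2) ^ 2 * h2 + φ v * c / 2 * (-1 : ℂ) * hII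
  · exact hx c hc h2

theorem add_left (hx : HasRoot K x φ) (hy : HasRoot K y φ) : HasRoot K (x + y) φ := by
  refine exists_of_sq fun c hc h2 => ?_
  -- If one order of the two factors is degenerate, the other is used; both being degenerate would
  -- force `2 + c φ(x + y) = 0`.
  by_cases hcy : 1 + c * φ y = 0
  · rw [add_comm x y] at hc ⊢
    refine exists_of_add_left hy hx hc fun hcx => h2 ?_
    rw [map_add]
    linear_combination hcx + hcy
  · exact exists_of_add_left hx hy hc hcy

theorem add_right (hx : HasRoot K x φ) (hy : HasRoot K x ψ) : HasRoot K x (φ + ψ) := by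
  refine exists_of_sq fun c hc h2 => ?_
  by_cases hcy : 1 + c * ψ x = 0
  · rw [add_comm φ ψ] at hc ⊢
    refine exists_of_add_right hy hx hc fun hcx => h2 ?_
    rw [LinearMap.add_apply]
    linear_combination hcx + hcy
  · exact exists_of_add_right hx hy hc hcy

/-- Two one-parameter groups of dilations in general position in a plane. -/
theorem of_plane (hx : HasRoot K x φ) (hy : HasRoot K y ψ) (h1 : φ x = 1) (h2 : ψ y = 1)
    (h0 : φ y * ψ x ≠ 0) (h3 : φ y * ψ x ≠ 1) (h4 : 2 * (φ y * ψ x) ≠ 1) : HasRoot K x ψ := by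
  obtain ⟨a, ha⟩ : ∃ a, φ y = a := ⟨_, rfl⟩
  obtain ⟨b, hb⟩ : ∃ b, ψ x = b := ⟨_, rfl⟩
  rw [ha, hb] at h0 h3 h4
  have ha0 : a ≠ 0 := left_ne_zero_of_mul h0
  have hb0 : b ≠ 0 := right_ne_zero_of_mul h0
  have hp : a * b - 1 ≠ 0 := sub_ne_zero.2 h3
  -- The coefficients are chosen so that `g₃ g₂ g₁` preserves the line of `x` (the `y`-component of
  -- the image of `x` cancels) but moves `φ` to a combination of `φ` and `ψ`. The coefficient of `ψ`
  -- is nonzero exactly because `2ab ≠ 1`.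
  obtain ⟨g₁, hg₁, e₁⟩ := hy ((a * b)⁻¹ - 1) (by rw [h2]; simpa using ⟨hb0, ha0⟩)
  obtain ⟨g₂, hg₂, e₂⟩ := hx (-(a * b)⁻¹) (by
    rw [h1]
    intro h
    apply hp
    field_simp at h
    linear_combination h)
  obtain ⟨g₃, hg₃, e₃⟩ := hy 1 (by rw [h2]; norm_num)
  have hβ : a * (2 * (a * b) - 1) / (a * b) ^ 2 ≠ 0 :=
    div_ne_zero (mul_ne_zero ha0 (sub_ne_zero.2 h4)) (pow_ne_zero _ h0)
  have key : HasRoot K ((a * b / (2 * (a * b - 1))) • x)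
      ((-(a * b)⁻¹) • φ + (a * (2 * (a * b) - 1) / (a * b) ^ 2) • ψ) := by
    refine hx.conj (K.mul_mem (K.mul_mem hg₃ hg₂) hg₁) ?_ ?_
    · simp only [Units.val_mul, Module.End.mul_apply, e₁, e₂, e₃, LinearMap.transvection.apply,
        map_add, map_smul, h1, h2, ha, hb]
      match_scalars
      · field_simp
        ring
      · field_simp
        ring
    · ext v
      simp only [Units.val_mul, Module.End.mul_apply, e₁, e₂, e₃, LinearMap.transvection.apply,
        map_add, map_smul, smul_eq_mul, h1, h2, ha, hb, LinearMap.comp_apply, LinearMap.add_apply,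
        LinearMap.smul_apply]
      field_simp
      ring
  -- Adding `(a * b)⁻¹ • φ` cancels the `φ`-part and leaves a nonzero multiple of `ψ`.
  have key' := (key.smul_left (2 * (a * b - 1) / (a * b))).add_right
    ((hx.smul_left 1).smul_right (a * b)⁻¹ |> fun h => by
      rwa [smul_smul, show 2 * (a * b - 1) / (a * b) * (a * b / (2 * (a * b - 1))) = 1 by
        field_simp])
  have key'' := key'.smul_right (a * (2 * (a * b) - 1) / (a * b) ^ 2)⁻¹
  rw [smul_smul, show 2 * (a * b - 1) / (a * b) * (a * b / (2 * (a * b - 1))) = 1 by field_simp,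
    one_smul] at key''
  convert key'' using 1
  rw [add_comm ((-(a * b)⁻¹) • φ), add_assoc, ← add_smul, neg_add_cancel, zero_smul, add_zero,
    smul_smul, inv_mul_cancel₀ hβ, one_smul]

/-- Conjugation by `1 + y ⊗ ψ` fixes `x` and replaces `φ` by `φ + φ(y) ψ`; subtracting `φ` isolates
`ψ`. -/
theorem extend_right (hx : HasRoot K x φ) (hy : HasRoot K y ψ) (h2 : ψ y = 1) (h0 : ψ x = 0)
    (h1 : φ y ≠ 0) : HasRoot K x ψ := by
  obtain ⟨g, hg, e⟩ := hy 1 (by rw [h2]; norm_num)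
  have key : HasRoot K x (φ + φ y • ψ) := by
    refine hx.conj hg (by simp [e, LinearMap.transvection.apply, h0]) ?_
    ext v
    simp [e, LinearMap.transvection.apply, mul_comm]
  have := (key.add_right (hx.smul_right (-1))).smul_right (φ y)⁻¹
  convert this using 1
  rw [neg_one_smul, add_neg_cancel_comm, smul_smul, inv_mul_cancel₀ h1, one_smul]

/-- The dual argument: `1 + y ⊗ ψ` now preserves `φ` and moves `x` along `y`. The factor `1/2` below
arises because this map doubles `y`. -/
theorem extend_left (hx : HasRoot K x φ) (hy : HasRoot K y ψ) (h2 : ψ y = 1) (h0 : φ y = 0)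
    (h1 : ψ x ≠ 0) : HasRoot K y φ := by
  obtain ⟨g, hg, e⟩ := hy 1 (by rw [h2]; norm_num)
  have key : HasRoot K (x + (-ψ x / 2) • y) φ := by
    refine hx.conj hg ?_ ?_
    · simp only [e, LinearMap.transvection.apply, map_add, map_smul, h2]
      module
    · ext v
      simp [e, LinearMap.transvection.apply, h0]
  have := (key.add_left (hx.smul_left (-1))).smul_left (-ψ x / 2)⁻¹
  convert this using 1
  rw [neg_one_smul, add_neg_cancel_comm, smul_smul, inv_mul_cancel₀, one_smul]
  exact div_ne_zero (neg_ne_zero.2 h1) two_ne_zero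

/-- A chain of dilations, any two neighbours of which are in general position. -/
theorem of_chain {m : ℕ} {x : Fin m → V} {φ : Fin m → Dual ℂ V} {a b : ℂ}
    (h : ∀ i, HasRoot K (x i) (φ i)) (h1 : ∀ i, φ i (x i) = 1)
    (ha : ∀ i j : Fin m, (i : ℕ) + 1 = j → φ i (x j) = a)
    (hb : ∀ i j : Fin m, (i : ℕ) + 1 = j → φ j (x i) = b)
    (h0 : ∀ i j : Fin m, (i : ℕ) + 1 < j → φ i (x j) = 0)
    (h0' : ∀ i j : Fin m, (i : ℕ) + 1 < j → φ j (x i) = 0)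
    (hab0 : a * b ≠ 0) (hab1 : a * b ≠ 1) (hab2 : 2 * (a * b) ≠ 1) (i j : Fin m) :
    HasRoot K (x i) (φ j) := by
  have key : ∀ (d : ℕ) (i j : Fin m), (i : ℕ) + d = j →
      HasRoot K (x i) (φ j) ∧ HasRoot K (x j) (φ i) := by
    intro d
    induction d with
    | zero =>
      intro i j hij
      obtain rfl : i = j := Fin.ext hij
      exact ⟨h i, h i⟩
    | succ d ih =>
      intro i j hij
      obtain rfl | hd := Nat.eq_zero_or_pos d
      · have hij' : (i : ℕ) + 1 = j := hij
        have hA := ha i j hij'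
        have hB := hb i j hij'
        exact ⟨(h i).of_plane (h j) (h1 i) (h1 j) (by rwa [hA, hB]) (by rwa [hA, hB])
            (by rwa [hA, hB]),
          (h j).of_plane (h i) (h1 j) (h1 i) (by rwa [hA, hB, mul_comm]) (by rwa [hA, hB, mul_comm])
            (by rwa [hA, hB, mul_comm b])⟩
      -- `l` is the neighbour of `j` on the side of `i`. As `i` and `j` are not adjacent, the
      -- pairings between them vanish, while those between `l` and `j` do not.
      · let l : Fin m := ⟨i + d, by omega⟩
        obtain ⟨ih1, ih2⟩ := ih i l rfl
        have hlj : (l : ℕ) + 1 = j := by simp only [l]; omega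
        refine ⟨ih1.extend_right (h j) (h1 j) (h0' i j (by omega)) ?_,
          ih2.extend_left (h j) (h1 j) (h0 i j (by omega)) ?_⟩
        · rw [ha l j hlj]; exact left_ne_zero_of_mul hab0
        · rw [hb l j hlj]; exact right_ne_zero_of_mul hab0
  rcases le_total i j with hij | hij
  · exact (key (j - i) i j (by have : (i : ℕ) ≤ j := hij; omega)).1
  · exact (key (i - j) j i (by have : (j : ℕ) ≤ i := hij; omega)).2

theorem of_span {ι : Type*} {x : ι → V} {φ : ι → Dual ℂ V} (h : ∀ i j, HasRoot K (x i) (φ j))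
    (hx : Submodule.span ℂ (Set.range x) = ⊤) (hφ : Submodule.span ℂ (Set.range φ) = ⊤)
    (v : V) (χ : Dual ℂ V) : HasRoot K v χ := by
  have hv : ∀ j, HasRoot K v (φ j) := fun j => by
    have hmem : v ∈ Submodule.span ℂ (Set.range x) := hx ▸ Submodule.mem_top
    induction hmem using Submodule.span_induction with
    | mem w hw => obtain ⟨i, rfl⟩ := hw; exact h i j
    | zero => exact zero_left K _
    | add w w' _ _ hw hw' => exact hw.add_left hw'
    | smul c w _ hw => exact hw.smul_left c
  have hmem : χ ∈ Submodule.span ℂ (Set.range φ) := hφ ▸ Submodule.mem_top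
  induction hmem using Submodule.span_induction with
  | mem w hw => obtain ⟨i, rfl⟩ := hw; exact hv i
  | zero => exact zero_right K _
  | add w w' _ _ hw hw' => exact hw.add_right hw'
  | smul c w _ hw => exact hw.smul_right c

end HasRoot

end Roots

/-! ### Special linear maps as products of commutators -/

section Commutators

open LinearMap (transvection)
open Module (Dual)
open scoped commutatorElement

/-- The subgroup generated by `S` normalizes `N`, and the generators commute modulo `N`; the
commutator identities for products and inverses carry this over to words. -/
theorem Subgroup.commutator_mem_of_closure {G : Type*} [Group G] {N : Subgroup G} {S : Set G}
    (hN : ∀ s ∈ S, s ∈ Subgroup.normalizer (N : Set G)) (hS : ∀ s ∈ S, ∀ t ∈ S, ⁅s, t⁆ ∈ N) {g h : G}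
    (hg : g ∈ Subgroup.closure S) (hh : h ∈ Subgroup.closure S) : ⁅g, h⁆ ∈ N := by
  have hcl : Subgroup.closure S ≤ Subgroup.normalizer (N : Set G) := (Subgroup.closure_le _).2 hN
  have hconj : ∀ k ∈ Subgroup.closure S, ∀ n ∈ N, k * n * k⁻¹ ∈ N := fun k hk n hn =>
    (Subgroup.mem_normalizer_iff.1 (hcl hk) n).1 hn
  have hconj' : ∀ k ∈ Subgroup.closure S, ∀ n ∈ N, k⁻¹ * n * k ∈ N := fun k hk n hn => by
    simpa using hconj k⁻¹ (inv_mem hk) n hn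
  induction hg, hh using Subgroup.closure_induction₂ with
  | mem x y hx hy => exact hS x hx y hy
  | one_left x hx => simp
  | one_right x hx => simp
  | mul_left x y z hx hy hz h1 h2 =>
    have : ⁅x * y, z⁆ = x * ⁅y, z⁆ * x⁻¹ * ⁅x, z⁆ := by simp only [commutatorElement_def]; group
    rw [this]
    exact mul_mem (hconj x hx _ h2) h1
  | mul_right y z x hy hz hx h1 h2 =>
    have : ⁅x, y * z⁆ = ⁅x, y⁆ * (y * ⁅x, z⁆ * y⁻¹) := by simp only [commutatorElement_def]; group
    rw [this]
    exact mul_mem h1 (hconj y hy _ h2)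
  | inv_left x y hx hy h1 =>
    have : ⁅x⁻¹, y⁆ = x⁻¹ * ⁅x, y⁆⁻¹ * x := by simp only [commutatorElement_def]; group
    rw [this]
    exact hconj' x hx _ (inv_mem h1)
  | inv_right x y hx hy h1 =>
    have : ⁅x, y⁻¹⁆ = y⁻¹ * ⁅x, y⁆⁻¹ * y := by simp only [commutatorElement_def]; group
    rw [this]
    exact hconj' y hy _ (inv_mem h1)

variable {V : Type*} [AddCommGroup V] [Module ℂ V]

/-- The special linear group of matrices, acting through a basis. -/
def Matrix.SpecialLinearGroup.toGeneralLinear {ι : Type*} [Fintype ι] [DecidableEq ι]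
    (b : Module.Basis ι ℂ V) :
    Matrix.SpecialLinearGroup ι ℂ →* LinearMap.GeneralLinearGroup ℂ V :=
  (Units.map (Matrix.toLinAlgEquiv b : Matrix ι ι ℂ →* Module.End ℂ V)).comp
    Matrix.SpecialLinearGroup.toGL

theorem Matrix.SpecialLinearGroup.coe_toGeneralLinear {ι : Type*} [Fintype ι] [DecidableEq ι]
    (b : Module.Basis ι ℂ V) (M : Matrix.SpecialLinearGroup ι ℂ) :
    (toGeneralLinear b M : Module.End ℂ V) = Matrix.toLin b b M.1 := rfl

theorem commutatorElement_units_eq {M : Type*} [Monoid M] {g h k : Mˣ}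
    (e : (g : M) * h = k * (h * g)) : ⁅g, h⁆ = k := by
  rw [commutatorElement_def, mul_inv_eq_iff_eq_mul, mul_inv_eq_iff_eq_mul, mul_assoc]
  exact Units.ext e

theorem mem_of_det_eq_one [FiniteDimensional ℂ V]
    {K N : Subgroup (LinearMap.GeneralLinearGroup ℂ V)} (hK : ∀ x φ, HasRoot K x φ)
    (hKN : ∀ g ∈ K, ∀ h ∈ K, ⁅g, h⁆ ∈ N) {g : LinearMap.GeneralLinearGroup ℂ V}
    (hg : LinearMap.det (g : Module.End ℂ V) = 1) : g ∈ N := by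
  let b := Module.finBasis ℂ V
  obtain ⟨M, rfl⟩ : ∃ M, Matrix.SpecialLinearGroup.toGeneralLinear b M = g := by
    let M : Matrix.SpecialLinearGroup (Fin (Module.finrank ℂ V)) ℂ :=
      ⟨LinearMap.toMatrix b b g, by rw [LinearMap.det_toMatrix, hg]⟩
    exact ⟨M, Units.ext ((Matrix.SpecialLinearGroup.coe_toGeneralLinear b M).trans
      (Matrix.toLin_toMatrix b b _))⟩
  -- In dimension at most one the special linear group is trivial; otherwise it is generated by
  -- transvections and the matrices with entries `c`, `c⁻¹` at two diagonal places and `1` at the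
  -- others.
  rcases subsingleton_or_nontrivial (Fin (Module.finrank ℂ V)) with hs | hs
  · rw [Subsingleton.elim M 1, map_one]
    exact one_mem N
  · clear hg
    induction M using Matrix.SpecialLinearGroup.diagonal_transvection_induction' with
    | @hdiag i j hij c hc =>
      obtain ⟨g, hgK, eg⟩ := hK (b i) (b.coord i) (c - 1) (by simpa using hc)
      -- `h` is the reflection exchanging `b i` and `b j`, so `⁅g, h⁆` scales `b i` by `c` and `b j`
      -- by `c⁻¹`.
      obtain ⟨h, hhK, eh⟩ := hK (b i - b j) (b.coord i - b.coord j) (-1)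
        (by simp [hij, hij.symm])
      have key := hKN g hgK h hhK
      rwa [commutatorElement_units_eq] at key
      rw [Matrix.SpecialLinearGroup.coe_toGeneralLinear, Matrix.SpecialLinearGroup.diag2n_coe,
        eg, eh]
      have hT : ∀ k, Matrix.toLin b b
          (Matrix.diagonal fun k ↦ if k = i then c else if k = j then c⁻¹ else 1) (b k) =
          (if k = i then c else if k = j then c⁻¹ else 1) • b k := fun k => by
        simp [Matrix.toLin_self, Matrix.diagonal_apply]
      refine b.ext fun k => ?_
      by_cases hki : k = i
      · subst hki
        simp [LinearMap.transvection.apply, hT, hij, hij.symm]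
        rw [smul_sub, smul_smul c c⁻¹, mul_inv_cancel₀ hc]
        module
      · by_cases hkj : k = j
        · subst hkj
          simp [LinearMap.transvection.apply, hT, hij]
          module
        · simp [LinearMap.transvection.apply, hT, hki, hkj]
    | htransvec i j hij a =>
      -- `g` doubles `b i`, so conjugation by `g` turns the coefficient `a` of the transvection `h`
      -- into `2a`, and `⁅g, h⁆ = h`.
      obtain ⟨g, hgK, eg⟩ := hK (b i) (b.coord i) 1 (by simp)
      obtain ⟨h, hhK, eh⟩ := hK (b i) (b.coord j) a
        (by simp [hij.symm])
      have key := hKN g hgK h hhK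
      rwa [commutatorElement_units_eq] at key
      rw [Matrix.SpecialLinearGroup.coe_toGeneralLinear, eg, eh]
      have hT : Matrix.toLin b b (Matrix.SpecialLinearGroup.transvection hij a).1 =
          transvection (b.coord j) (a • b i) := by
        refine b.ext fun k => ?_
        rw [Matrix.toLin_self, Matrix.SpecialLinearGroup.transvection_coe]
        simp [Matrix.add_apply, add_smul, Finset.sum_add_distrib, Matrix.one_apply,
          Matrix.single_apply, LinearMap.transvection.apply, ite_and, Finsupp.single_apply, eq_comm]
      rw [hT]
      ext v
      simp [LinearMap.transvection.apply, hij.symm]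
      module
    | hmul A B hA hB =>
      rw [map_mul]
      exact N.mul_mem hA hB

end Commutators

/-! ### The Zariski closure of a subgroup containing multiples of dilations -/

section ZariskiClosure

open LinearMap (transvection GeneralLinearGroup)
open Module (Dual)
open Polynomial (X C)
open scoped commutatorElement

variable {V : Type*} [AddCommGroup V] [Module ℂ V]

theorem mem_zariskiClosure_iff {S : Set (GeneralLinearGroup ℂ V)} {g : GeneralLinearGroup ℂ V} :
    g ∈ zariskiClosure S ↔ ∀ c ∈ regularFunctions V, (∀ s ∈ S, c s = 0) → c g = 0 := by
  constructor
  · intro hg c hc hS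
    have := hg {h | ∀ c' ∈ ({c} : Set _), c' h = 0}
      ⟨⟨{c}, by simpa using hc, rfl⟩, fun s hs => by simpa using hS s hs⟩
    simpa using this
  · rintro h Z ⟨⟨I, hI, rfl⟩, hSZ⟩ c hc
    exact h c (hI hc) fun s hs => hSZ hs c hc

theorem subset_zariskiClosure (S : Set (GeneralLinearGroup ℂ V)) : S ⊆ zariskiClosure S :=
  fun _ hs => mem_zariskiClosure_iff.2 fun _ _ h => h _ hs

theorem matrixCoeff_mem_regularFunctions (φ : Dual ℂ V) (v : V) :
    (fun g : GeneralLinearGroup ℂ V => φ ((g : Module.End ℂ V) v)) ∈ regularFunctions V :=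
  Algebra.subset_adjoin (Or.inl ⟨φ, v, rfl⟩)

theorem inv_det_mem_regularFunctions :
    (fun g : GeneralLinearGroup ℂ V => (LinearMap.det (g : Module.End ℂ V))⁻¹) ∈
      regularFunctions V :=
  Algebra.subset_adjoin (Or.inr rfl)

theorem translate_mem_regularFunctions (A B : GeneralLinearGroup ℂ V)
    {c : GeneralLinearGroup ℂ V → ℂ} (hc : c ∈ regularFunctions V) :
    (fun g => c (A * g * B)) ∈ regularFunctions V := by
  induction hc using Algebra.adjoin_induction with
  | mem c hc =>
    rcases hc with ⟨φ, v, rfl⟩ | rfl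
    · exact matrixCoeff_mem_regularFunctions (φ ∘ₗ (A : Module.End ℂ V)) ((B : Module.End ℂ V) v)
    · have := (regularFunctions V).smul_mem (inv_det_mem_regularFunctions (V := V))
        ((LinearMap.det (A : Module.End ℂ V))⁻¹ * (LinearMap.det (B : Module.End ℂ V))⁻¹)
      convert this using 1
      ext g
      simp only [Units.val_mul, map_mul, mul_inv, Pi.smul_apply, smul_eq_mul]
      ring
  | algebraMap r => exact (regularFunctions V).algebraMap_mem r
  | add c c' _ _ hc hc' => exact add_mem hc hc'
  | mul c c' _ _ hc hc' => exact mul_mem hc hc'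

theorem translate_mem_zariskiClosure {S T : Set (GeneralLinearGroup ℂ V)}
    {A B g : GeneralLinearGroup ℂ V} (h : ∀ s ∈ S, A * s * B ∈ zariskiClosure T)
    (hg : g ∈ zariskiClosure S) : A * g * B ∈ zariskiClosure T := by
  rw [mem_zariskiClosure_iff]
  intro c hc hT
  exact mem_zariskiClosure_iff.1 hg _ (translate_mem_regularFunctions A B hc) fun s hs =>
    mem_zariskiClosure_iff.1 (h s hs) c hc hT

/-- The largest subgroup contained in the Zariski closure of a subgroup (in fact, all of it). -/
def Subgroup.zariskiClosure (Γ : Subgroup (GeneralLinearGroup ℂ V)) :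
    Subgroup (GeneralLinearGroup ℂ V) where
  carrier := {g | g ∈ _root_.zariskiClosure (Γ : Set (GeneralLinearGroup ℂ V)) ∧
    g⁻¹ ∈ _root_.zariskiClosure (Γ : Set (GeneralLinearGroup ℂ V))}
  one_mem' := by
    have := subset_zariskiClosure _ Γ.one_mem
    exact ⟨this, by rwa [inv_one]⟩
  inv_mem' := fun ⟨h, h'⟩ => ⟨h', by rwa [inv_inv]⟩
  mul_mem' := by
    -- Only translations are known to be continuous, so the two factors are moved into the closure
    -- one at a time.
    have key : ∀ g ∈ _root_.zariskiClosure (Γ : Set (GeneralLinearGroup ℂ V)),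
        ∀ h ∈ _root_.zariskiClosure (Γ : Set (GeneralLinearGroup ℂ V)),
          g * h ∈ _root_.zariskiClosure (Γ : Set (GeneralLinearGroup ℂ V)) := by
      intro g hg h hh
      rw [← one_mul g]
      refine translate_mem_zariskiClosure (fun s hs => ?_) hg
      rw [one_mul, ← mul_one (s * h)]
      refine translate_mem_zariskiClosure (fun t ht => ?_) hh
      rw [mul_one]
      exact subset_zariskiClosure _ (Γ.mul_mem hs ht)
    rintro g h ⟨hg, hg'⟩ ⟨hh, hh'⟩
    exact ⟨key g hg h hh, by rw [mul_inv_rev]; exact key _ hh' _ hg'⟩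

theorem Subgroup.le_zariskiClosure (Γ : Subgroup (GeneralLinearGroup ℂ V)) :
    Γ ≤ Γ.zariskiClosure := fun _ hg =>
  ⟨subset_zariskiClosure _ hg, subset_zariskiClosure _ (Γ.inv_mem hg)⟩

theorem Subgroup.conj_mem_zariskiClosure {Γ : Subgroup (GeneralLinearGroup ℂ V)}
    {A g : GeneralLinearGroup ℂ V} (h : ∀ s ∈ Γ, A * s * A⁻¹ ∈ Γ.zariskiClosure)
    (hg : g ∈ Γ.zariskiClosure) : A * g * A⁻¹ ∈ Γ.zariskiClosure := by
  refine ⟨translate_mem_zariskiClosure (fun s hs => (h s hs).1) hg.1, ?_⟩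
  rw [show (A * g * A⁻¹)⁻¹ = A * g⁻¹ * A⁻¹ by group]
  exact translate_mem_zariskiClosure (fun s hs => (h s hs).1) hg.2

/-- The one-parameter group of dilations with centre `x` and axis `ker φ`. -/
def dilation (x : V) (φ : Dual ℂ V) (h : φ x = 1) : ℂˣ →* GeneralLinearGroup ℂ V :=
  MonoidHom.toHomUnits
    { toFun := fun t => transvection φ (((t : ℂ) - 1) • x)
      map_one' := by ext v; simp
      map_mul' := fun s t => by
        ext v
        simp only [LinearMap.transvection.apply, Module.End.mul_apply, map_add, map_smul, h,
          Units.val_mul]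
        module }

variable {x : V} {φ : Dual ℂ V} (h : φ x = 1)

theorem coe_dilation (t : ℂˣ) :
    (dilation x φ h t : Module.End ℂ V) = transvection φ (((t : ℂ) - 1) • x) := rfl

theorem dilation_apply (t : ℂˣ) (v : V) :
    (dilation x φ h t : Module.End ℂ V) v = v + (((t : ℂ) - 1) * φ v) • x := by
  rw [coe_dilation, LinearMap.transvection.apply, smul_smul, mul_comm]

/-- Matrix coefficients of a dilation are affine in `t`, those of its inverse affine in `t⁻¹`, and
the determinant of the product does not depend on `t`. -/
theorem exists_laurent (A B D : GeneralLinearGroup ℂ V) {c : GeneralLinearGroup ℂ V → ℂ}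
    (hc : c ∈ regularFunctions V) : ∃ (N : ℕ) (P : Polynomial ℂ), ∀ t : ℂˣ,
      (t : ℂ) ^ N * c (A * dilation x φ h t * B * (dilation x φ h t)⁻¹ * D) = P.eval (t : ℂ) := by
  induction hc using Algebra.adjoin_induction with
  | mem c hc =>
    rcases hc with ⟨χ, v, rfl⟩ | rfl
    · let A' : Module.End ℂ V := A
      let B' : Module.End ℂ V := B
      let w : V := (D : Module.End ℂ V) v
      refine ⟨1, X * (C (χ (A' (B' w))) + (X - 1) * C (φ (B' w) * χ (A' x))) +
        (1 - X) * C (φ w) * (C (χ (A' (B' x))) + (X - 1) * C (φ (B' x) * χ (A' x))), fun t => ?_⟩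
      have ht : (t : ℂ) ≠ 0 := t.ne_zero
      rw [← map_inv]
      simp only [Units.val_mul, Module.End.mul_apply, dilation_apply, map_add, map_smul,
        smul_eq_mul, Units.val_inv_eq_inv_val, Polynomial.eval_add, Polynomial.eval_mul,
        Polynomial.eval_sub, Polynomial.eval_one, Polynomial.eval_X, Polynomial.eval_C, A', B', w]
      field_simp
    · refine ⟨0, C (LinearMap.det ((A * B * D : GeneralLinearGroup ℂ V) : Module.End ℂ V))⁻¹,
        fun t => ?_⟩
      have : ∀ g : GeneralLinearGroup ℂ V,
          LinearMap.det ((A * g * B * g⁻¹ * D : GeneralLinearGroup ℂ V) : Module.End ℂ V) =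
            LinearMap.det ((A * B * D : GeneralLinearGroup ℂ V) : Module.End ℂ V) := by
        intro g
        have hg : LinearMap.det (g : Module.End ℂ V) *
            LinearMap.det ((g⁻¹ : GeneralLinearGroup ℂ V) : Module.End ℂ V) = 1 := by
          rw [← map_mul, ← Units.val_mul, mul_inv_cancel, Units.val_one, map_one]
        simp only [Units.val_mul, map_mul]
        linear_combination LinearMap.det (A : Module.End ℂ V) *
          LinearMap.det (B : Module.End ℂ V) * LinearMap.det (D : Module.End ℂ V) * hg
      change _ * (LinearMap.det _)⁻¹ = _
      rw [this, pow_zero, one_mul, Polynomial.eval_C]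
  | algebraMap r => exact ⟨0, C r, fun t => by simp⟩
  | add c c' _ _ hc hc' =>
    obtain ⟨N, P, hP⟩ := hc
    obtain ⟨N', P', hP'⟩ := hc'
    refine ⟨N + N', X ^ N' * P + X ^ N * P', fun t => ?_⟩
    simp only [Pi.add_apply, Polynomial.eval_add, Polynomial.eval_mul, Polynomial.eval_pow,
      Polynomial.eval_X, ← hP t, ← hP' t]
    ring
  | mul c c' _ _ hc hc' =>
    obtain ⟨N, P, hP⟩ := hc
    obtain ⟨N', P', hP'⟩ := hc'
    refine ⟨N + N', P * P', fun t => ?_⟩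
    simp only [Pi.mul_apply, Polynomial.eval_mul, ← hP t, ← hP' t]
    ring

/-- A Laurent polynomial vanishing at the infinitely many points `r ^ m` is zero. -/
theorem dilation_conj_mem_zariskiClosure {S : Set (GeneralLinearGroup ℂ V)}
    {A B D : GeneralLinearGroup ℂ V} {r : ℂˣ} (hr : ∀ m : ℕ, 0 < m → r ^ m ≠ 1)
    (hS : ∀ m : ℕ, A * dilation x φ h (r ^ m) * B * (dilation x φ h (r ^ m))⁻¹ * D ∈
      zariskiClosure S) (t : ℂˣ) :
    A * dilation x φ h t * B * (dilation x φ h t)⁻¹ * D ∈ zariskiClosure S := by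
  rw [mem_zariskiClosure_iff]
  intro c hc hcS
  obtain ⟨N, P, hP⟩ := exists_laurent h A B D hc
  have hP0 : P = 0 := by
    have hinj : Function.Injective fun m : ℕ => ((r ^ m : ℂˣ) : ℂ) :=
      Units.val_injective.comp (injective_pow_iff_not_isOfFinOrder.2 fun hfin => by
        obtain ⟨m, hm, hm'⟩ := isOfFinOrder_iff_pow_eq_one.1 hfin
        exact hr m hm hm')
    refine Polynomial.eq_zero_of_infinite_isRoot P ((Set.infinite_range_of_injective hinj).mono ?_)
    rintro _ ⟨m, rfl⟩
    change P.eval _ = 0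
    rw [← hP, mem_zariskiClosure_iff.1 (hS m) c hc hcS, mul_zero]
  have := hP t
  rw [hP0, Polynomial.eval_zero, mul_eq_zero] at this
  exact this.resolve_left (pow_ne_zero _ t.ne_zero)

/-- If a group of matrices contains central multiples of dilations of infinite order and the
corresponding one-parameter groups generate all dilations, then its Zariski closure contains the
special linear group. -/
theorem mem_zariskiClosure_of_det_eq_one [FiniteDimensional ℂ V]
    {Γ : Subgroup (GeneralLinearGroup ℂ V)} {ι : Type*} {x : ι → V} {φ : ι → Dual ℂ V}
    (h : ∀ i, φ i (x i) = 1) {r : ℂˣ} (hr : ∀ m : ℕ, 0 < m → r ^ m ≠ 1)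
    {z : GeneralLinearGroup ℂ V} (hz : z ∈ Subgroup.center (GeneralLinearGroup ℂ V))
    (hΓ : ∀ i, z * dilation (x i) (φ i) (h i) r ∈ Γ)
    (hroot : ∀ v χ, HasRoot (Subgroup.closure
      (⋃ i, Set.range (dilation (x i) (φ i) (h i)))) v χ)
    {g : GeneralLinearGroup ℂ V} (hg : LinearMap.det (g : Module.End ℂ V) = 1) :
    g ∈ zariskiClosure (Γ : Set (GeneralLinearGroup ℂ V)) := by
  have hpow : ∀ i (m : ℕ), z ^ m * dilation (x i) (φ i) (h i) (r ^ m) ∈ Γ := fun i m => by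
    have hcomm : Commute z (dilation (x i) (φ i) (h i) r) := (Subgroup.mem_center_iff.1 hz _).symm
    rw [map_pow, ← hcomm.mul_pow]
    exact Γ.pow_mem (hΓ i) m
  have hzm : ∀ m : ℕ, z ^ m ∈ Subgroup.center (GeneralLinearGroup ℂ V) := fun m =>
    Subgroup.pow_mem _ hz m
  have hcancel : ∀ (m : ℕ) (a b : GeneralLinearGroup ℂ V),
      (z ^ m * a) * b * (z ^ m * a)⁻¹ = a * b * a⁻¹ := fun m a b => by
    have h1 := Subgroup.mem_center_iff.1 (hzm m) (a * b * a⁻¹)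
    rw [mul_inv_rev, show z ^ m * a * b * (a⁻¹ * (z ^ m)⁻¹) = z ^ m * (a * b * a⁻¹) * (z ^ m)⁻¹ by
      group, ← h1, mul_inv_cancel_right]
  have hconj : ∀ i t, ∀ s ∈ Γ, dilation (x i) (φ i) (h i) t * s * (dilation (x i) (φ i) (h i) t)⁻¹ ∈
      zariskiClosure (Γ : Set (GeneralLinearGroup ℂ V)) := by
    intro i t s hs
    have := dilation_conj_mem_zariskiClosure (h i) (A := 1) (B := s) (D := 1)
      (S := (Γ : Set (GeneralLinearGroup ℂ V))) hr (fun m => ?_) t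
    · simpa using this
    · simp only [one_mul, mul_one]
      rw [← hcancel m]
      exact subset_zariskiClosure _ (Γ.mul_mem (Γ.mul_mem (hpow i m) hs) (Γ.inv_mem (hpow i m)))
  have hconj' : ∀ i t, ∀ s ∈ Γ,
      dilation (x i) (φ i) (h i) t * s * (dilation (x i) (φ i) (h i) t)⁻¹ ∈ Γ.zariskiClosure := by
    intro i t s hs
    refine ⟨hconj i t s hs, ?_⟩
    have := hconj i t s⁻¹ (Γ.inv_mem hs)
    convert this using 1
    group
  have hnorm : ∀ s ∈ ⋃ i, Set.range (dilation (x i) (φ i) (h i)),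
      s ∈ Subgroup.normalizer (Γ.zariskiClosure : Set (GeneralLinearGroup ℂ V)) := by
    intro s hs
    obtain ⟨i, t, rfl⟩ := Set.mem_iUnion.1 hs
    refine Subgroup.mem_normalizer_iff.2 fun k =>
      ⟨fun hk => Subgroup.conj_mem_zariskiClosure (hconj' i t) hk, fun hk => ?_⟩
    have := Subgroup.conj_mem_zariskiClosure (hconj' i t⁻¹) hk
    rw [map_inv] at this
    convert this using 1
    group
  -- The commutator is viewed as a curve in `u`. At `u = r ^ m` the central factor `z ^ m` can be
  -- inserted freely, making it a conjugate of an element of `Γ` by `d_i(t)`, times the inverse of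
  -- that element.
  have hcomm : ∀ i j t u, ⁅dilation (x i) (φ i) (h i) t, dilation (x j) (φ j) (h j) u⁆ ∈
      zariskiClosure (Γ : Set (GeneralLinearGroup ℂ V)) := by
    intro i j t u
    have := dilation_conj_mem_zariskiClosure (h j) (A := dilation (x i) (φ i) (h i) t)
      (B := (dilation (x i) (φ i) (h i) t)⁻¹) (D := 1)
      (S := (Γ : Set (GeneralLinearGroup ℂ V))) hr (fun m => ?_) u
    · simpa [commutatorElement_def] using this
    · have hmem := Γ.zariskiClosure.mul_mem (hconj' i t _ (hpow j m))
        (Γ.le_zariskiClosure (Γ.inv_mem (hpow j m)))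
      convert hmem.1 using 1
      have := hcancel m (dilation (x j) (φ j) (h j) (r ^ m)) (dilation (x i) (φ i) (h i) t)⁻¹
      rw [mul_one, mul_assoc, mul_assoc, ← mul_assoc (dilation (x j) (φ j) (h j) (r ^ m)), ← this]
      group
  have hmem : g ∈ Γ.zariskiClosure :=
    mem_of_det_eq_one hroot (fun a ha b hb => Subgroup.commutator_mem_of_closure hnorm
      (fun s hs t ht => by
        obtain ⟨i, s, rfl⟩ := Set.mem_iUnion.1 hs
        obtain ⟨j, t, rfl⟩ := Set.mem_iUnion.1 ht
        refine ⟨hcomm i j s t, ?_⟩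
        rw [commutatorElement_inv]
        exact hcomm j i t s) ha hb) hg
  exact hmem.1

end ZariskiClosure

/-! ### Endomorphisms of tensor powers and Zariski closures -/

section TensorPowers

open LinearMap (GeneralLinearGroup)
open Module (Dual)

variable {V : Type*} [AddCommGroup V] [Module ℂ V]

/-- Expanding in a basis, the coefficients of `g ⊗ ⋯ ⊗ g` are polynomials in those of `g`. -/
theorem tensorCoeff_mem_regularFunctions [FiniteDimensional ℂ V] {k : ℕ}
    (Λ : Dual ℂ (⨂[ℂ] _ : Fin k, V)) (u : ⨂[ℂ] _ : Fin k, V) :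
    (fun g : GeneralLinearGroup ℂ V =>
      Λ (PiTensorProduct.map (fun _ => (g : Module.End ℂ V)) u)) ∈ regularFunctions V := by
  induction u using PiTensorProduct.induction_on with
  | smul_tprod c v =>
    let b := Module.finBasis ℂ V
    have key : (fun g : GeneralLinearGroup ℂ V =>
        Λ (PiTensorProduct.map (fun _ => (g : Module.End ℂ V)) (c • PiTensorProduct.tprod ℂ v))) =
        c • ∑ j : Fin k → Fin (Module.finrank ℂ V),
          Λ (PiTensorProduct.tprod ℂ fun i => b (j i)) •
          ∏ i, fun g : GeneralLinearGroup ℂ V => b.coord (j i) ((g : Module.End ℂ V) (v i)) := by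
      ext g
      have hg : (fun i => (g : Module.End ℂ V) (v i)) =
          fun i => ∑ l, b.coord l ((g : Module.End ℂ V) (v i)) • b l := by
        ext i
        exact (b.sum_repr _).symm
      rw [map_smul, map_smul, PiTensorProduct.map_tprod, hg, MultilinearMap.map_sum, map_sum]
      simp only [MultilinearMap.map_smul_univ, map_smul, smul_eq_mul, Pi.smul_apply,
        Finset.sum_apply, Finset.prod_apply, mul_comm]
    rw [key]
    exact Subalgebra.smul_mem _ (sum_mem fun j _ => Subalgebra.smul_mem _
      (prod_mem fun i _ => matrixCoeff_mem_regularFunctions _ _) _) _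
  | add u u' hu hu' =>
    simp only [map_add]
    exact add_mem hu hu'

theorem mem_tensorPowerEnd_iff {G : Type*} [Group G] {ρ : G →* GeneralLinearGroup ℂ V} {k : ℕ}
    {a : Module.End ℂ (⨂[ℂ] _ : Fin k, V)} : a ∈ tensorPowerEnd ρ k ↔
      ∀ g u, PiTensorProduct.map (fun _ => (ρ g : Module.End ℂ V)) (a u) =
        a (PiTensorProduct.map (fun _ => (ρ g : Module.End ℂ V)) u) := by
  simp only [tensorPowerEnd, Subalgebra.mem_centralizer_iff, Set.forall_mem_range,
    LinearMap.ext_iff, Module.End.mul_apply]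

theorem commute_of_mem_zariskiClosure [FiniteDimensional ℂ V] {G : Type*} [Group G]
    {ρ : G →* GeneralLinearGroup ℂ V} {k : ℕ} {a : Module.End ℂ (⨂[ℂ] _ : Fin k, V)}
    (ha : a ∈ tensorPowerEnd ρ k) {g : GeneralLinearGroup ℂ V}
    (hg : g ∈ zariskiClosure (Set.range ρ)) (u : ⨂[ℂ] _ : Fin k, V) :
    PiTensorProduct.map (fun _ => (g : Module.End ℂ V)) (a u) =
      a (PiTensorProduct.map (fun _ => (g : Module.End ℂ V)) u) := by
  rw [← sub_eq_zero, ← Module.forall_dual_apply_eq_zero_iff ℂ]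
  intro Λ
  rw [map_sub]
  refine mem_zariskiClosure_iff.1 hg _ (sub_mem (tensorCoeff_mem_regularFunctions Λ (a u))
    (tensorCoeff_mem_regularFunctions (Λ ∘ₗ a) u)) ?_
  rintro _ ⟨s, rfl⟩
  simp [mem_tensorPowerEnd_iff.1 ha s u]

theorem PiTensorProduct.map_const_smul {k : ℕ} (c : ℂ) (T : Module.End ℂ V) :
    PiTensorProduct.map (fun _ : Fin k => c • T) = c ^ k • PiTensorProduct.map fun _ => T := by
  have := (PiTensorProduct.mapMultilinear ℂ (fun _ : Fin k => V) (fun _ => V)).map_smul_univ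
    (fun _ => c) fun _ => T
  simpa using this

/-- `c` is a root of `det g` of order `dim V`; dimension zero is separate, having no such root to
extract. -/
theorem exists_smul_det_eq_one [FiniteDimensional ℂ V] (g : GeneralLinearGroup ℂ V) :
    ∃ (c : ℂ) (s : GeneralLinearGroup ℂ V), LinearMap.det (s : Module.End ℂ V) = 1 ∧
      (g : Module.End ℂ V) = c • (s : Module.End ℂ V) := by
  have hdet : LinearMap.det (g : Module.End ℂ V) ≠ 0 :=
    ((LinearMap.isUnit_iff_isUnit_det _).1 g.isUnit).ne_zero
  rcases Nat.eq_zero_or_pos (Module.finrank ℂ V) with h0 | hpos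
  · exact ⟨1, g, LinearMap.det_eq_one_of_finrank_eq_zero h0 _, (one_smul _ _).symm⟩
  · obtain ⟨c, hc⟩ := IsAlgClosed.exists_pow_nat_eq (LinearMap.det (g : Module.End ℂ V)) hpos
    have hc0 : c ≠ 0 := by
      rintro rfl
      rw [zero_pow hpos.ne'] at hc
      exact hdet hc.symm
    refine ⟨c, (Units.mk0 c hc0)⁻¹ • g, ?_, ?_⟩
    · rw [Units.val_smul, Units.smul_def, LinearMap.det_smul, ← hc, Units.val_inv_eq_inv_val,
        Units.val_mk0, inv_pow, inv_mul_cancel₀ (pow_ne_zero _ hc0)]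
    · rw [Units.val_smul, Units.smul_def, smul_smul, Units.val_inv_eq_inv_val, Units.val_mk0,
        mul_inv_cancel₀ hc0, one_smul]

theorem tensorPowerEnd_eq_of_zariskiClosure [FiniteDimensional ℂ V] {G : Type*} [Group G]
    {ρ : G →* GeneralLinearGroup ℂ V}
    (h : {g : GeneralLinearGroup ℂ V | LinearMap.det (g : Module.End ℂ V) = 1} ⊆
      zariskiClosure (Set.range ρ)) (k : ℕ) :
    tensorPowerEnd ρ k = tensorPowerEnd (MonoidHom.id (GeneralLinearGroup ℂ V)) k := by
  refine le_antisymm (fun a ha => mem_tensorPowerEnd_iff.2 fun g u => ?_)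
    fun a ha => mem_tensorPowerEnd_iff.2 fun g u => mem_tensorPowerEnd_iff.1 ha (ρ g) u
  obtain ⟨c, s, hs, hg⟩ := exists_smul_det_eq_one g
  rw [MonoidHom.id_apply, hg, PiTensorProduct.map_const_smul, LinearMap.smul_apply,
    LinearMap.smul_apply, map_smul, commute_of_mem_zariskiClosure ha (h hs)]

end TensorPowers

/-! ### The reduced Burau representation -/

namespace Burau

open LinearMap (GeneralLinearGroup)
open Module (Dual)

variable {n : ℕ}

/-- The vector `f_i`, as an element of `F`. -/
def root (q₁ q₂ : ℂ) (i : Fin (n - 1)) : F n q₁ q₂ :=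
  ⟨f q₁ q₂ i, Submodule.subset_span ⟨i, rfl⟩⟩

/-- The linear form on `F` vanishing on the fixed hyperplane of `q₁⁻¹ σ_i`, with value `1` at
`f_i`. -/
def coroot (q₁ q₂ : ℂ) (i : Fin (n - 1)) : Dual ℂ (F n q₁ q₂) :=
  (q₂ - q₁)⁻¹ • (LinearMap.proj (R := ℂ) (φ := fun _ : Fin n => ℂ) (lo i) -
    LinearMap.proj (R := ℂ) (φ := fun _ : Fin n => ℂ) (hi i)) ∘ₗ (F n q₁ q₂).subtype

theorem coroot_apply (q₁ q₂ : ℂ) (i : Fin (n - 1)) (v : F n q₁ q₂) :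
    coroot q₁ q₂ i v = (q₂ - q₁)⁻¹ * (v.1 (lo i) - v.1 (hi i)) := rfl

theorem f_apply (q₁ q₂ : ℂ) (i : Fin (n - 1)) (j : Fin n) :
    f q₁ q₂ i j = (if (j : ℕ) = i then q₂ else 0) + if (j : ℕ) = i + 1 then q₁ else 0 := by
  simp [f, e, Pi.single_apply, lo, hi, Fin.ext_iff]

theorem coroot_root (q₁ q₂ : ℂ) (i j : Fin (n - 1)) :
    coroot q₁ q₂ i (root q₁ q₂ j) = (q₂ - q₁)⁻¹ *
      ((if (i : ℕ) = j then q₂ - q₁ else 0) + (if (i : ℕ) = j + 1 then q₁ else 0) -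
        if (i : ℕ) + 1 = j then q₂ else 0) := by
  rw [coroot_apply]
  change _ * (f q₁ q₂ j (lo i) - f q₁ q₂ j (hi i)) = _
  rw [f_apply, f_apply]
  simp only [lo, hi, add_left_inj]
  by_cases h : (i : ℕ) = j
  · simp only [h, if_true]
    ring
  · simp only [h, if_false]
    ring_nf

theorem span_root (q₁ q₂ : ℂ) : Submodule.span ℂ (Set.range (root (n := n) q₁ q₂)) = ⊤ := by
  apply Submodule.map_injective_of_injective (F n q₁ q₂).injective_subtype
  rw [Submodule.map_span, Submodule.map_top, Submodule.range_subtype, ← Set.range_comp]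
  rfl

/-- The linear form `v ↦ ∑ qⁱ vᵢ` vanishes on `F`. -/
theorem sum_pow_mul_eq_zero {q₁ q : ℂ} {v : Fin n → ℂ} (hv : v ∈ F n q₁ (-q * q₁)) :
    ∑ i : Fin n, q ^ (i : ℕ) * v i = 0 := by
  induction hv using Submodule.span_induction with
  | mem v hv =>
    obtain ⟨i, rfl⟩ := hv
    have h : ∀ j : Fin n, q ^ (j : ℕ) * f q₁ (-q * q₁) i j =
        (if j = lo i then q ^ (j : ℕ) * (-q * q₁) else 0) +
          if j = hi i then q ^ (j : ℕ) * q₁ else 0 := fun j => by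
      rw [f_apply, mul_add, mul_ite, mul_ite, mul_zero]
      simp [lo, hi, Fin.ext_iff]
    rw [Finset.sum_congr rfl fun j _ => h j, Finset.sum_add_distrib, Finset.sum_ite_eq',
      Finset.sum_ite_eq']
    simp only [Finset.mem_univ, if_true, lo, hi]
    ring
  | zero => simp
  | add v w _ _ hv hw => simp [mul_add, Finset.sum_add_distrib, hv, hw]
  | smul c v _ hv =>
    simp only [Pi.smul_apply, smul_eq_mul, mul_left_comm _ c, ← Finset.mul_sum, hv, mul_zero]

/-- A vector killed by all coroots has equal coordinates. Lying in `F`, it is also killed by `∑ qⁱ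
vᵢ`, and `1 + q + ⋯ + q^(n-1) ≠ 0` because `q ^ n ≠ 1`. -/
theorem span_coroot (hn : 1 ≤ n) {q₁ q : ℂ} (hq : ∀ m : ℕ, 0 < m → q ^ m ≠ 1)
    (hd : -q * q₁ - q₁ ≠ 0) :
    Submodule.span ℂ (Set.range (coroot (n := n) q₁ (-q * q₁))) = ⊤ := by
  have hbot : (Submodule.span ℂ (Set.range (coroot (n := n) q₁ (-q * q₁)))).dualCoannihilator =
      ⊥ := by
    rw [eq_bot_iff]
    intro v hv
    rw [Submodule.mem_dualCoannihilator] at hv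
    have hstep : ∀ i : Fin (n - 1), v.1 (lo i) = v.1 (hi i) := fun i => by
      have := hv _ (Submodule.subset_span ⟨i, rfl⟩)
      rw [coroot_apply, mul_eq_zero, sub_eq_zero] at this
      exact this.resolve_left (inv_ne_zero hd)
    have hconst : ∀ (k : ℕ) (hk : k < n), v.1 ⟨k, hk⟩ = v.1 ⟨0, hn⟩ := by
      intro k
      induction k with
      | zero => exact fun _ => rfl
      | succ k ih => exact fun hk => (hstep ⟨k, by omega⟩).symm.trans (ih (by omega))
    have hsum := sum_pow_mul_eq_zero v.2
    rw [Finset.sum_congr rfl fun i _ => by rw [hconst i i.2], ← Finset.sum_mul,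
      Fin.sum_univ_eq_sum_range (fun i => q ^ i) n, mul_eq_zero] at hsum
    have hv0 := hsum.resolve_left fun h0 => hq n hn (by
      rw [← sub_eq_zero, ← geom_sum_mul, h0, zero_mul])
    rw [Submodule.mem_bot]
    exact Subtype.ext (funext fun i => (hconst i i.2).trans hv0)
  rw [← Subspace.dualCoannihilator_dualAnnihilator_eq (W := Submodule.span ℂ _), hbot,
    Submodule.dualAnnihilator_bot]

theorem det_eq_one_subset_zariskiClosure (hn : 1 ≤ n) {q₁ q₂ : ℂ} (hq : q₁ * q₂ ≠ 0)
    (hroot : ∀ m : ℕ, 0 < m → (-q₂ / q₁) ^ m ≠ 1) :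
    {g : GeneralLinearGroup ℂ (F n q₁ q₂) | LinearMap.det (g : Module.End ℂ (F n q₁ q₂)) = 1} ⊆
      zariskiClosure (Set.range (reducedBurau n q₁ q₂ hq)) := by
  have hq₁ : q₁ ≠ 0 := left_ne_zero_of_mul hq
  have hq₂ : q₂ ≠ 0 := right_ne_zero_of_mul hq
  obtain ⟨q, rfl⟩ : ∃ q, q₂ = -q * q₁ := ⟨-q₂ / q₁, by field_simp⟩
  have hq0 : q ≠ 0 := by
    rintro rfl
    simp at hq₂
  have hqq : -(-q * q₁) / q₁ = q := by field_simp
  rw [hqq] at hroot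
  have h1 : 1 + q ≠ 0 := fun h => hroot 2 two_pos (by linear_combination (q - 1) * h)
  -- Adjacent pairings have product `ab = q / (1 + q)²`. Thus `h2` excludes `2ab = 1` and `h3`
  -- excludes `ab = 1`, while `h1` makes `q₂ ≠ q₁`, so that the coroots can be normalized.
  have h2 : 1 + q ^ 2 ≠ 0 := fun h => hroot 4 four_pos (by linear_combination (q ^ 2 - 1) * h)
  have h3 : 1 + q + q ^ 2 ≠ 0 := fun h => hroot 3 three_pos (by linear_combination (q - 1) * h)
  have hd : -q * q₁ - q₁ ≠ 0 := by
    rw [show -q * q₁ - q₁ = -((1 + q) * q₁) by ring]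
    exact neg_ne_zero.2 (mul_ne_zero h1 hq₁)
  have hone : ∀ i : Fin (n - 1), coroot q₁ (-q * q₁) i (root q₁ (-q * q₁) i) = 1 := fun i => by
    rw [coroot_root]
    simpa using inv_mul_cancel₀ hd
  have hr : ∀ m : ℕ, 0 < m → (-(Units.mk0 q hq0)) ^ m ≠ 1 := fun m hm h => by
    refine hroot (2 * m) (by omega) ?_
    have h' := congrArg (fun u : ℂˣ => (u : ℂ)) h
    simp only [Units.val_pow_eq_pow_val, Units.val_neg, Units.val_mk0, Units.val_one] at h'
    rw [pow_mul, ← neg_sq, ← pow_mul, mul_comm, pow_mul, h', one_pow]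
  let z : GeneralLinearGroup ℂ (F n q₁ (-q * q₁)) := Units.mk0 q₁ hq₁ • 1
  have hz : z ∈ Subgroup.center _ := Subgroup.mem_center_iff.2 fun g => by
    refine Units.ext (LinearMap.ext fun v => ?_)
    simp [z, Units.smul_def]
  -- The generator `σ_i` acts as `q₁` times the dilation with parameter `-q = q₂ / q₁`.
  have hgen : ∀ i : Fin (n - 1),
      z * dilation _ _ (hone i) (-(Units.mk0 q hq0)) ∈ (reducedBurau n q₁ (-q * q₁) hq).range := by
    intro i
    refine ⟨PresentedGroup.of i, ?_⟩
    refine Units.ext (LinearMap.ext fun v => Subtype.ext ?_)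
    have hop : (burau n q₁ (-q * q₁) hq (PresentedGroup.of i) : Module.End ℂ (Fin n → ℂ)) =
        op q₁ (-q * q₁) i := congrArg Units.val (PresentedGroup.toGroup.of _)
    change (burau n q₁ (-q * q₁) hq (PresentedGroup.of i) : Module.End ℂ (Fin n → ℂ)) v.1 =
      q₁ • ((dilation _ _ (hone i) (-(Units.mk0 q hq0)) : Module.End ℂ (F n q₁ (-q * q₁))) v).1
    rw [hop, op_eq, dilation_apply, coroot_apply]
    change _ = q₁ • (v.1 + _ • f q₁ (-q * q₁) i)
    rw [smul_add, smul_smul, Units.val_neg, Units.val_mk0]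
    congr 2
    rw [show -q * q₁ - q₁ = -((1 + q) * q₁) by ring]
    field_simp
    ring
  have hall := HasRoot.of_span (K := Subgroup.closure
      (⋃ i : Fin (n - 1), Set.range (dilation _ _ (hone i))))
    (HasRoot.of_chain (a := -q / (1 + q)) (b := -1 / (1 + q)) ?_ hone ?_ ?_ ?_ ?_ ?_ ?_ ?_)
    (span_root q₁ (-q * q₁)) (span_coroot hn hroot hd)
  · intro g hg
    have := mem_zariskiClosure_of_det_eq_one hone hr hz hgen hall hg
    rwa [MonoidHom.coe_range] at this
  · intro i c hc
    rw [hone, mul_one] at hc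
    refine ⟨dilation _ _ (hone i) (Units.mk0 _ hc),
      Subgroup.subset_closure (Set.mem_iUnion.2 ⟨i, _, rfl⟩), ?_⟩
    rw [coe_dilation, Units.val_mk0, add_sub_cancel_left]
  · intro i j hij
    rw [coroot_root, if_neg (by omega), if_neg (by omega), if_pos hij,
      show -q * q₁ - q₁ = -((1 + q) * q₁) by ring]
    field_simp
    ring
  · intro i j hij
    rw [coroot_root, if_neg (by omega), if_pos hij.symm, if_neg (by omega),
      show -q * q₁ - q₁ = -((1 + q) * q₁) by ring]
    field_simp
    ring
  · intro i j hij
    rw [coroot_root, if_neg (by omega), if_neg (by omega), if_neg (by omega)]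
    simp
  · intro i j hij
    rw [coroot_root, if_neg (by omega), if_neg (by omega), if_neg (by omega)]
    simp
  · exact mul_ne_zero (div_ne_zero (neg_ne_zero.2 hq0) h1) (div_ne_zero (by norm_num) h1)
  · intro h
    field_simp at h
    exact h3 (by linear_combination -h)
  · intro h
    field_simp at h
    exact h2 (by linear_combination -h)

end Burau

end

theorem theorem5p2 (n : ℕ) (hn : 1 ≤ n) (q₁ q₂ : ℂ) (hq : q₁ * q₂ ≠ 0)
    (hroot : ∀ m : ℕ, 0 < m → (-q₂ / q₁) ^ m ≠ 1) :
    {g : LinearMap.GeneralLinearGroup ℂ (Burau.F n q₁ q₂) |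
        LinearMap.det (g : Module.End ℂ (Burau.F n q₁ q₂)) = 1} ⊆
      zariskiClosure (Set.range (Burau.reducedBurau n q₁ q₂ hq)) ∧
    ∀ k : ℕ,
      tensorPowerEnd (Burau.reducedBurau n q₁ q₂ hq) k =
        tensorPowerEnd (MonoidHom.id (LinearMap.GeneralLinearGroup ℂ (Burau.F n q₁ q₂))) k :=
  ⟨Burau.det_eq_one_subset_zariskiClosure hn hq hroot,
    tensorPowerEnd_eq_of_zariskiClosure (Burau.det_eq_one_subset_zariskiClosure hn hq hroot)⟩
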